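/- Let $E$ be a complex Banach lattice, that is, the complexification $E = E_{\mathbb R} \oplus iE_{\mathbb R}$ of a real Banach lattice $E_{\mathbb R}$, with modulus $|x+iy| = \sup_{\theta\in\mathbb R}(\cos\theta\, x + \sin\theta\, y)$ and norm $\|z\| = \|\,|z|\,\|$; for $z,w\in E_{\mathbb R}$, $z\le w$ refers to the order of $E_{\mathbb R}$. Let $T$ be a bounded linear operator on $E$ which is positive, i.e. $Tx \ge 0$ whenever $x \ge 0$. For $\lambda\in\mathbb C$, a sequence $(x_n)_{n\in\mathbb N}$ in $E$ is called an approximate eigenvector of $T$ for $\lambda$ if $0<\liminf_n\|x_n\|\le\limsup_n\|x_n\|<\infty$ and $(\lambda-T)x_n\to 0$; if such a sequence exists, $\lambda$ is called an approximate eigenvalue of $T$. Let $r>0$ and $\theta\in\mathbb R$, and let $re^{i\theta}$ be an approximate eigenvalue of $T$ which satisfies the dominated approximate eigenvector condition: there are approximate eigenvectors $(z_n)$ of $T$ for $re^{i\theta}$ and $(x_n)$ of $T$ for $r$ such that $|z_n|\le x_n$ for all $n\in\mathbb N$. Then $re^{ik\theta}\in\sigma(T)$ for all $k\in\mathbb Z$.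 -/

import Mathlib

/-!
Real Banach lattices are given by Mathlib's classes: a complete real normed space `E` with a
vector lattice order (`Lattice`, `IsOrderedAddMonoid`, `IsOrderedModule ℝ`) and a solid norm
(`HasSolidNorm`). A complex Banach lattice is the complexification `E ⊕ iE` of a real Banach
lattice `E`, with the modulus `|x + iy| = sup_θ (cos θ • x + sin θ • y)` and the norm
`‖z‖ = ‖|z|‖`.
-/

set_option linter.unusedSectionVars false

/-- The complexification `E ⊕ iE` of a real vector space `E`. -/
@[ext]
structure Complexification (E : Type*) where
  /-- real part -/
  re : E
  /-- imaginary part -/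
  im : E

namespace Complexification

section Algebra

variable {E : Type*} [AddCommGroup E]

instance : Zero (Complexification E) := ⟨⟨0, 0⟩⟩
instance : Add (Complexification E) := ⟨fun z w => ⟨z.re + w.re, z.im + w.im⟩⟩
instance : Neg (Complexification E) := ⟨fun z => ⟨-z.re, -z.im⟩⟩
instance : Sub (Complexification E) := ⟨fun z w => ⟨z.re - w.re, z.im - w.im⟩⟩

@[simp] theorem zero_re : (0 : Complexification E).re = 0 := rfl
@[simp] theorem zero_im : (0 : Complexification E).im = 0 := rfl
@[simp] theorem add_re (z w : Complexification E) : (z + w).re = z.re + w.re := rfl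
@[simp] theorem add_im (z w : Complexification E) : (z + w).im = z.im + w.im := rfl
@[simp] theorem neg_re (z : Complexification E) : (-z).re = -z.re := rfl
@[simp] theorem neg_im (z : Complexification E) : (-z).im = -z.im := rfl
@[simp] theorem sub_re (z w : Complexification E) : (z - w).re = z.re - w.re := rfl
@[simp] theorem sub_im (z w : Complexification E) : (z - w).im = z.im - w.im := rfl

instance : AddCommGroup (Complexification E) where
  add_assoc a b c := by ext <;> simp [add_assoc]
  zero_add a := by ext <;> simp
  add_zero a := by ext <;> simp
  nsmul := nsmulRec
  zsmul := zsmulRec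
  neg_add_cancel a := by ext <;> simp
  sub_eq_add_neg a b := by ext <;> simp [sub_eq_add_neg]
  add_comm a b := by ext <;> simp [add_comm]

/-- The embedding of the real part `E` into `E ⊕ iE`. -/
def ofReal (x : E) : Complexification E := ⟨x, 0⟩

variable [Module ℝ E]

instance : SMul ℂ (Complexification E) :=
  ⟨fun c z => ⟨c.re • z.re - c.im • z.im, c.re • z.im + c.im • z.re⟩⟩

@[simp] theorem smul_re (c : ℂ) (z : Complexification E) :
    (c • z).re = c.re • z.re - c.im • z.im := rfl
@[simp] theorem smul_im (c : ℂ) (z : Complexification E) :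
    (c • z).im = c.re • z.im + c.im • z.re := rfl

instance : Module ℂ (Complexification E) where
  one_smul z := by ext <;> simp
  mul_smul a b z := by ext <;> simp <;> module
  smul_zero a := by ext <;> simp
  smul_add a z w := by ext <;> simp <;> module
  add_smul a b z := by ext <;> simp <;> module
  zero_smul z := by ext <;> simp

end Algebra

/-- The order of `E ⊕ iE` induced by the positive cone of `E`: `z ≤ w` means that `w - z` is
real and positive. -/
instance {E : Type*} [PartialOrder E] : PartialOrder (Complexification E) where
  le z w := z.re ≤ w.re ∧ z.im = w.im
  le_refl z := ⟨le_rfl, rfl⟩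
  le_trans _ _ _ h₁ h₂ := ⟨h₁.1.trans h₂.1, h₁.2.trans h₂.2⟩
  le_antisymm _ _ h₁ h₂ := Complexification.ext (le_antisymm h₁.1 h₂.1) h₁.2

theorem le_def {E : Type*} [PartialOrder E] {z w : Complexification E} :
    z ≤ w ↔ z.re ≤ w.re ∧ z.im = w.im := Iff.rfl

/-- The real part `cos θ • x + sin θ • y` of `e^{-iθ} (x + iy)`. -/
noncomputable def rotRe {E : Type*} [AddCommGroup E] [Module ℝ E]
    (z : Complexification E) (θ : ℝ) : E :=
  Real.cos θ • z.re + Real.sin θ • z.im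

section Lattice

variable {E : Type*} [NormedAddCommGroup E] [Lattice E] [HasSolidNorm E] [IsOrderedAddMonoid E]
  [NormedSpace ℝ E] [IsOrderedModule ℝ E]

theorem smul_le_abs_smul_abs (a : ℝ) (x : E) : a • x ≤ |a| • |x| := by
  rcases le_total 0 a with h | h
  · rw [abs_of_nonneg h]
    exact smul_le_smul_of_nonneg_left (le_abs_self x) h
  · rw [abs_of_nonpos h, ← neg_smul_neg]
    exact smul_le_smul_of_nonneg_left (neg_le_abs x) (neg_nonneg.2 h)

theorem rotRe_le_add (z : Complexification E) (s t : ℝ) :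
    rotRe z s ≤ rotRe z t + |s - t| • (|z.re| + |z.im|) := by
  have h1 : |Real.cos s - Real.cos t| ≤ |s - t| := by
    simpa [Real.dist_eq] using Real.lipschitzWith_cos.dist_le_mul s t
  have h2 : |Real.sin s - Real.sin t| ≤ |s - t| := by
    simpa [Real.dist_eq] using Real.lipschitzWith_sin.dist_le_mul s t
  have e : rotRe z s = rotRe z t + ((Real.cos s - Real.cos t) • z.re
      + (Real.sin s - Real.sin t) • z.im) := by
    unfold rotRe; module
  rw [e, smul_add]
  gcongr
  · exact (smul_le_abs_smul_abs _ _).trans (smul_le_smul_of_nonneg_right h1 (abs_nonneg _))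
  · exact (smul_le_abs_smul_abs _ _).trans (smul_le_smul_of_nonneg_right h2 (abs_nonneg _))

theorem exists_finset_rotRe (z : Complexification E) (N : ℕ) :
    ∃ s : E, s ∈ lowerBounds (upperBounds (Set.range (rotRe z))) ∧
      ∀ θ, rotRe z θ ≤ s + (2 * Real.pi / (N + 1)) • (|z.re| + |z.im|) := by
  have hpi := Real.two_pi_pos
  have hN : (0 : ℝ) < N + 1 := by positivity
  set δ : ℝ := 2 * Real.pi / (N + 1) with hδ
  have hδ0 : 0 < δ := by positivity
  refine ⟨(Finset.range (N + 1)).sup' Finset.nonempty_range_add_one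
    (fun j => rotRe z (δ * j)), ?_, ?_⟩
  · intro b hb
    exact Finset.sup'_le _ _ fun j _ => hb ⟨_, rfl⟩
  · intro θ
    have hper : rotRe z θ = rotRe z (toIcoMod hpi 0 θ) := by
      have : toIcoMod hpi 0 θ = θ - (toIcoDiv hpi 0 θ) * (2 * Real.pi) := by
        rw [← zsmul_eq_mul]; rfl
      unfold rotRe
      rw [this, Real.cos_sub_int_mul_two_pi, Real.sin_sub_int_mul_two_pi]
    rw [hper]
    obtain ⟨h0, h1⟩ := toIcoMod_mem_Ico hpi 0 θ
    set t := toIcoMod hpi 0 θ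
    rw [zero_add] at h1
    have hfl := Nat.floor_le (div_nonneg h0 hδ0.le)
    have hlt := Nat.lt_floor_add_one (t / δ)
    have hmem : ⌊t / δ⌋₊ ∈ Finset.range (N + 1) := by
      rw [Finset.mem_range, Nat.floor_lt (div_nonneg h0 hδ0.le), div_lt_iff₀ hδ0, hδ]
      push_cast
      rwa [mul_div_cancel₀ _ hN.ne']
    rw [le_div_iff₀ hδ0] at hfl
    rw [div_lt_iff₀ hδ0] at hlt
    have habs : |t - δ * ⌊t / δ⌋₊| ≤ δ := by
      rw [abs_le]; constructor <;> nlinarith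
    refine (rotRe_le_add z t (δ * ⌊t / δ⌋₊)).trans ?_
    have := Finset.le_sup' (fun j : ℕ => rotRe z (δ * j)) hmem
    have h3 : (0 : E) ≤ |z.re| + |z.im| := add_nonneg (abs_nonneg _) (abs_nonneg _)
    exact add_le_add this (smul_le_smul_of_nonneg_right habs h3)

/-- In a Banach lattice the supremum defining the modulus exists. -/
theorem exists_isLUB_rotRe [CompleteSpace E] (z : Complexification E) :
    ∃ m : E, IsLUB (Set.range (rotRe z)) m := by
  choose s hs hs' using exists_finset_rotRe z
  set u := |z.re| + |z.im| with hu
  have hu0 : (0 : E) ≤ u := add_nonneg (abs_nonneg _) (abs_nonneg _)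
  set d : ℕ → ℝ := fun N => 2 * Real.pi / (N + 1) with hd
  have hd0 : ∀ N, 0 ≤ d N := fun N => by
    have := Real.two_pi_pos
    simp only [hd]; positivity
  have hlim : Filter.Tendsto d Filter.atTop (nhds 0) := by
    have := (tendsto_one_div_add_atTop_nhds_zero_nat (𝕜 := ℝ)).const_mul (2 * Real.pi)
    simpa [hd, div_eq_mul_inv] using this
  have hanti : ∀ M N, M ≤ N → d N ≤ d M := fun M N h => by
    have := Real.two_pi_pos
    simp only [hd]; gcongr
  have hle : ∀ M N, s M ≤ s N + d N • u := fun M N =>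
    hs M (by rintro _ ⟨θ, rfl⟩; exact hs' N θ)
  have hcau : CauchySeq s := by
    refine cauchySeq_of_le_tendsto_0 (fun N => d N * ‖u‖) ?_ (by simpa using hlim.mul_const ‖u‖)
    intro n m N hn hm
    rw [dist_eq_norm, ← abs_of_nonneg (hd0 N), ← Real.norm_eq_abs, ← norm_smul]
    apply norm_le_norm_of_abs_le_abs
    rw [abs_of_nonneg (smul_nonneg (hd0 N) hu0)]
    refine abs_le'.2 ⟨?_, ?_⟩
    · rw [sub_le_iff_le_add']
      exact (hle n m).trans (by gcongr; exact hanti _ _ hm)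
    · rw [neg_sub, sub_le_iff_le_add']
      exact (hle m n).trans (by gcongr; exact hanti _ _ hn)
  obtain ⟨m, hm⟩ := cauchySeq_tendsto_of_complete hcau
  refine ⟨m, ?_, ?_⟩
  · rintro _ ⟨θ, rfl⟩
    have : Filter.Tendsto (fun N => s N + d N • u) Filter.atTop (nhds m) := by
      simpa using hm.add (hlim.smul_const u)
    exact ge_of_tendsto' this fun N => hs' N θ
  · intro b hb
    exact le_of_tendsto' hm fun N => hs N hb

variable [CompleteSpace E]

/-- The modulus `|x + iy| = sup_θ (cos θ • x + sin θ • y)`, an element of `E`. -/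
noncomputable def modulus (z : Complexification E) : E := (exists_isLUB_rotRe z).choose

theorem isLUB_modulus (z : Complexification E) : IsLUB (Set.range (rotRe z)) (modulus z) :=
  (exists_isLUB_rotRe z).choose_spec

theorem rotRe_le_modulus (z : Complexification E) (θ : ℝ) : rotRe z θ ≤ modulus z :=
  (isLUB_modulus z).1 ⟨θ, rfl⟩

theorem modulus_le {z : Complexification E} {b : E} (h : ∀ θ, rotRe z θ ≤ b) : modulus z ≤ b :=
  (isLUB_modulus z).2 (by rintro _ ⟨θ, rfl⟩; exact h θ)

theorem abs_re_le_modulus (z : Complexification E) : |z.re| ≤ modulus z := by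
  refine abs_le'.2 ⟨?_, ?_⟩
  · simpa [rotRe] using rotRe_le_modulus z 0
  · simpa [rotRe] using rotRe_le_modulus z Real.pi

theorem abs_im_le_modulus (z : Complexification E) : |z.im| ≤ modulus z := by
  refine abs_le'.2 ⟨?_, ?_⟩
  · simpa [rotRe] using rotRe_le_modulus z (Real.pi / 2)
  · simpa [rotRe] using rotRe_le_modulus z (-(Real.pi / 2))

theorem modulus_nonneg (z : Complexification E) : 0 ≤ modulus z :=
  (abs_nonneg _).trans (abs_re_le_modulus z)

theorem modulus_le_add (z : Complexification E) : modulus z ≤ |z.re| + |z.im| := by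
  refine modulus_le fun θ => ?_
  unfold rotRe
  gcongr
  · refine (smul_le_abs_smul_abs _ _).trans ?_
    simpa using smul_le_smul_of_nonneg_right (Real.abs_cos_le_one θ) (abs_nonneg z.re)
  · refine (smul_le_abs_smul_abs _ _).trans ?_
    simpa using smul_le_smul_of_nonneg_right (Real.abs_sin_le_one θ) (abs_nonneg z.im)

theorem modulus_ofReal (x : E) : modulus (ofReal x) = |x| := by
  apply le_antisymm
  · simpa [ofReal] using modulus_le_add (ofReal x)
  · simpa [ofReal] using abs_re_le_modulus (ofReal x)

theorem modulus_add_le (z w : Complexification E) : modulus (z + w) ≤ modulus z + modulus w := by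
  refine modulus_le fun θ => ?_
  have : rotRe (z + w) θ = rotRe z θ + rotRe w θ := by
    simp only [rotRe, add_re, add_im]; module
  rw [this]
  exact add_le_add (rotRe_le_modulus z θ) (rotRe_le_modulus w θ)

theorem modulus_smul_le (c : ℂ) (z : Complexification E) : modulus (c • z) ≤ ‖c‖ • modulus z := by
  refine modulus_le fun θ => ?_
  have hre : c.re = ‖c‖ * Real.cos c.arg := (Complex.norm_mul_cos_arg c).symm
  have him : c.im = ‖c‖ * Real.sin c.arg := (Complex.norm_mul_sin_arg c).symm
  have : rotRe (c • z) θ = ‖c‖ • rotRe z (θ - c.arg) := by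
    simp only [rotRe, smul_re, smul_im, Real.cos_sub, Real.sin_sub]
    rw [hre, him]
    module
  rw [this]
  exact smul_le_smul_of_nonneg_left (rotRe_le_modulus z _) (norm_nonneg c)

/-- The norm `‖z‖ = ‖|z|‖`. -/
noncomputable instance : Norm (Complexification E) := ⟨fun z => ‖modulus z‖⟩

theorem norm_def (z : Complexification E) : ‖z‖ = ‖modulus z‖ := rfl

theorem norm_le_of_le {a b : E} (ha : 0 ≤ a) (h : a ≤ b) : ‖a‖ ≤ ‖b‖ :=
  norm_le_norm_of_abs_le_abs (by rwa [abs_of_nonneg ha, abs_of_nonneg (ha.trans h)])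

theorem norm_re_le (z : Complexification E) : ‖z.re‖ ≤ ‖z‖ := by
  rw [← norm_abs_eq_norm]
  exact norm_le_of_le (abs_nonneg _) (abs_re_le_modulus z)

theorem norm_im_le (z : Complexification E) : ‖z.im‖ ≤ ‖z‖ := by
  rw [← norm_abs_eq_norm]
  exact norm_le_of_le (abs_nonneg _) (abs_im_le_modulus z)

theorem norm_le_add (z : Complexification E) : ‖z‖ ≤ ‖z.re‖ + ‖z.im‖ := by
  rw [← norm_abs_eq_norm z.re, ← norm_abs_eq_norm z.im]
  exact (norm_le_of_le (modulus_nonneg z) (modulus_le_add z)).trans (norm_add_le _ _)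

theorem normCore : NormedSpace.Core ℂ (Complexification E) where
  norm_nonneg z := norm_nonneg (modulus z)
  norm_smul c z := by
    have key : ∀ (c : ℂ) (z : Complexification E), ‖c • z‖ ≤ ‖c‖ * ‖z‖ := fun c z => by
      have := norm_le_of_le (modulus_nonneg _) (modulus_smul_le c z)
      rwa [norm_smul, norm_norm] at this
    refine le_antisymm (key c z) ?_
    rcases eq_or_ne c 0 with rfl | hc
    · rw [norm_zero, zero_mul]
      exact norm_nonneg (modulus ((0 : ℂ) • z))
    · have h := key c⁻¹ (c • z)
      rw [inv_smul_smul₀ hc, norm_inv] at h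
      rwa [← le_inv_mul_iff₀ (norm_pos_iff.2 hc)]
  norm_triangle z w :=
    (norm_le_of_le (modulus_nonneg _) (modulus_add_le z w)).trans (norm_add_le _ _)
  norm_eq_zero_iff z := by
    constructor
    · intro h
      have h1 := norm_re_le z
      have h2 := norm_im_le z
      rw [h] at h1 h2
      exact Complexification.ext (norm_le_zero_iff.1 h1) (norm_le_zero_iff.1 h2)
    · rintro rfl
      refine le_antisymm ?_ (norm_nonneg (modulus (0 : Complexification E)))
      simpa using norm_le_add (0 : Complexification E)

noncomputable instance : NormedAddCommGroup (Complexification E) :=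
  NormedAddCommGroup.ofCore normCore

noncomputable instance : NormedSpace ℂ (Complexification E) := NormedSpace.ofCore normCore

instance : CompleteSpace (Complexification E) := by
  refine Metric.complete_of_cauchySeq_tendsto fun z hz => ?_
  have hre : CauchySeq fun n => (z n).re := by
    rw [Metric.cauchySeq_iff] at hz ⊢
    intro ε hε
    obtain ⟨N, hN⟩ := hz ε hε
    refine ⟨N, fun m hm n hn => lt_of_le_of_lt ?_ (hN m hm n hn)⟩
    rw [dist_eq_norm, dist_eq_norm]
    exact norm_re_le (z m - z n)
  have him : CauchySeq fun n => (z n).im := by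
    rw [Metric.cauchySeq_iff] at hz ⊢
    intro ε hε
    obtain ⟨N, hN⟩ := hz ε hε
    refine ⟨N, fun m hm n hn => lt_of_le_of_lt ?_ (hN m hm n hn)⟩
    rw [dist_eq_norm, dist_eq_norm]
    exact norm_im_le (z m - z n)
  obtain ⟨x, hx⟩ := cauchySeq_tendsto_of_complete hre
  obtain ⟨y, hy⟩ := cauchySeq_tendsto_of_complete him
  refine ⟨⟨x, y⟩, ?_⟩
  rw [tendsto_iff_norm_sub_tendsto_zero] at hx hy ⊢
  refine squeeze_zero (fun n => norm_nonneg _) (fun n => norm_le_add _) ?_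
  simpa using hx.add hy

end Lattice

end Complexification

/-- `T E₊ ⊆ E₊`. -/
def IsPositiveOperator {E : Type*} [NormedAddCommGroup E] [Lattice E] [HasSolidNorm E]
    [IsOrderedAddMonoid E] [NormedSpace ℝ E] [IsOrderedModule ℝ E] [CompleteSpace E]
    (T : Complexification E →L[ℂ] Complexification E) : Prop :=
  ∀ x : Complexification E, 0 ≤ x → 0 ≤ T x

/-- `(x n)` is an approximate eigenvector of `T` for `μ`:
`0 < liminf ‖x n‖ ≤ limsup ‖x n‖ < ∞` (in `[0, ∞]`) and `(μ - T) (x n) → 0`. -/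
def IsApproximateEigenvector {X : Type*} [NormedAddCommGroup X] [NormedSpace ℂ X]
    (T : X →L[ℂ] X) (μ : ℂ) (x : ℕ → X) : Prop :=
  0 < Filter.liminf (fun n => ‖x n‖ₑ) Filter.atTop ∧
  Filter.limsup (fun n => ‖x n‖ₑ) Filter.atTop < ⊤ ∧
  Filter.Tendsto (fun n => μ • x n - T (x n)) Filter.atTop (nhds 0)

/-- `μ` is an approximate eigenvalue of `T`. -/
def IsApproximateEigenvalue {X : Type*} [NormedAddCommGroup X] [NormedSpace ℂ X]
    (T : X →L[ℂ] X) (μ : ℂ) : Prop :=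
  ∃ x : ℕ → X, IsApproximateEigenvector T μ x

/-- The dominated approximate eigenvector condition: there are approximate eigenvectors `(z n)`
for `μ` and `(x n)` for `|μ|` with `|z n| ≤ x n` for all `n`. -/
def DominatedApproximateEigenvectorCondition {E : Type*} [NormedAddCommGroup E] [Lattice E]
    [HasSolidNorm E] [IsOrderedAddMonoid E] [NormedSpace ℝ E] [IsOrderedModule ℝ E]
    [CompleteSpace E] (T : Complexification E →L[ℂ] Complexification E) (μ : ℂ) : Prop :=
  ∃ z x : ℕ → Complexification E,
    IsApproximateEigenvector T μ z ∧ IsApproximateEigenvector T (‖μ‖ : ℂ) x ∧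
      ∀ n, Complexification.ofReal (Complexification.modulus (z n)) ≤ x n

open Filter Topology

/-! ### Homogeneous powers of the phase of a complex number -/

/-! Divide `T` by `r` and put `μ = exp(iθ)`. If `μ ^ k` is not in the spectrum, then `‖v‖ ≤ M‖μ ^ k
v - T v‖`. The natural candidate for an eigenvector at `μ ^ k` is `w = |z|(z/|z|)^k`. Since `|z n|`
is merely dominated by the almost fixed `x n`, this candidate may fail, and an inequality replaces
it.

For large `C` the function `F_c(v) = C|c||v| + Re(c|v|(v/|v|)^k)` is convex
(`IsPhaseBound.isSublinear`). Sublinear functions act on the lattice as suprema of linear minorants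
(`supEval`). There `F_c(z) = Re(c w) + C|z|` defines `w` (`exists_phasePow`), and positivity gives
`F(Tz) ≤ A F(z)`, where `A` is `T` on the real part. With `Tz ≈ μz` and the tangent bound `(C+1) Re
v ≤ F_1(v)`, summing over powers yields `N(C+1)|z| ≤ |∑ μ^(-kj) T^j w| + C ∑ A^j|z| + errors` over
`j < N` (`smul_modulus_le`).

Applying `μ ^ k - T` telescopes the first sum, so its norm is bounded independently of `N` up to a
null sequence. Dividing by `N(C+1)`, a bound `|z n| ≤ a x n + o(1)` improves to the constant
`aC/(C+1)` (`exists_modulus_le_improved`). Iteration forces `z n → 0`, contradicting the positive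
liminf. -/

theorem exists_norm_zpow_sub_le (k : ℤ) :
    ∃ C : ℝ, 1 ≤ C ∧ ∀ ζ : ℂ, ‖ζ‖ = 1 →
      ‖ζ ^ k - (ζ.re + k * ζ.im * Complex.I)‖ ≤ C * (1 - ζ.re) := by
  have sq_norm : ∀ ζ : ℂ, ‖ζ‖ = 1 → ‖ζ - 1‖ ^ 2 = 2 * (1 - ζ.re) := fun ζ hζ => by
    have h : ζ.re * ζ.re + ζ.im * ζ.im = 1 := by
      rw [← Complex.normSq_apply, Complex.normSq_eq_norm_sq, hζ, one_pow]
    rw [← Complex.normSq_eq_norm_sq, Complex.normSq_apply]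
    simp only [Complex.sub_re, Complex.sub_im, Complex.one_re, Complex.one_im]
    linarith
  -- Second order Taylor bound at 1: on the circle `‖ζ - 1‖ ^ 2` equals `2 (1 - Re ζ)`, so quadratic
  -- errors are admissible.
  have quad : ∀ n : ℕ, ∃ C : ℝ, 0 ≤ C ∧ ∀ ζ : ℂ, ‖ζ‖ = 1 →
      ‖ζ ^ n - 1 - n * (ζ - 1)‖ ≤ C * (1 - ζ.re) := by
    intro n
    induction n with
    | zero => exact ⟨0, le_rfl, fun ζ _ => by simp⟩
    | succ n ih =>
      obtain ⟨C, hC, h⟩ := ih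
      refine ⟨C + 2 * n, by positivity, fun ζ hζ => ?_⟩
      have e : ζ ^ (n + 1) - 1 - ((n + 1 : ℕ) : ℂ) * (ζ - 1)
          = ζ * (ζ ^ n - 1 - n * (ζ - 1)) + n * (ζ - 1) ^ 2 := by
        push_cast; ring
      rw [e]
      refine (norm_add_le _ _).trans ?_
      rw [norm_mul, hζ, one_mul, norm_mul, norm_pow, sq_norm ζ hζ, Complex.norm_natCast]
      linarith [h ζ hζ]
  have nat : ∀ n : ℕ, ∃ C : ℝ, 1 ≤ C ∧ ∀ ζ : ℂ, ‖ζ‖ = 1 →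
      ‖ζ ^ n - (ζ.re + n * ζ.im * Complex.I)‖ ≤ C * (1 - ζ.re) := by
    intro n
    obtain ⟨C, hC, h⟩ := quad n
    refine ⟨C + (n + 1), by linarith [n.cast_nonneg (α := ℝ)], fun ζ hζ => ?_⟩
    have e : ζ ^ n - (ζ.re + n * ζ.im * Complex.I)
        = (ζ ^ n - 1 - n * (ζ - 1)) + ((1 - n : ℝ) * (1 - ζ.re : ℝ) : ℂ) := by
      push_cast
      linear_combination (-n : ℂ) * Complex.re_add_im ζ
    have h0 : 0 ≤ 1 - ζ.re := by
      have := Complex.re_le_norm ζ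
      linarith
    have h1 : |(1 - n : ℝ)| ≤ n + 1 := by
      rw [abs_le]; constructor <;> linarith [n.cast_nonneg (α := ℝ)]
    rw [e]
    refine (norm_add_le _ _).trans ?_
    rw [norm_mul, Complex.norm_real, Complex.norm_real, Real.norm_eq_abs, Real.norm_eq_abs,
      abs_of_nonneg h0, add_mul]
    exact add_le_add (h ζ hζ) (mul_le_mul_of_nonneg_right h1 h0)
  obtain ⟨n, rfl | rfl⟩ := k.eq_nat_or_neg
  · obtain ⟨C, hC, h⟩ := nat n
    exact ⟨C, hC, fun ζ hζ => by simpa using h ζ hζ⟩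
  · obtain ⟨C, hC, h⟩ := nat n
    refine ⟨C, hC, fun ζ hζ => ?_⟩
    -- Conjugation keeps `Re ζ` and flips `Im ζ`, which matches the sign of `k`.
    have hi : ζ⁻¹ = starRingEnd ℂ ζ := by
      rw [Complex.inv_def, Complex.normSq_eq_norm_sq, hζ]; simp
    have := h (starRingEnd ℂ ζ) (by simpa using hζ)
    rw [zpow_neg, zpow_natCast, ← inv_pow, hi]
    simpa using this

/-- The homogeneous power `|v| (v / |v|) ^ k`. -/
noncomputable def phasePow (k : ℤ) (v : ℂ) : ℂ := ‖v‖ * (v / ‖v‖) ^ k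

theorem norm_phasePow_le (k : ℤ) (v : ℂ) : ‖phasePow k v‖ ≤ ‖v‖ := by
  rcases eq_or_ne v 0 with rfl | hv
  · simp [phasePow]
  · have : ‖v‖ ≠ 0 := norm_ne_zero_iff.2 hv
    simp [phasePow, norm_zpow, div_self this]

theorem phasePow_mul (k : ℤ) {μ : ℂ} (hμ : ‖μ‖ = 1) (v : ℂ) :
    phasePow k (μ * v) = μ ^ k * phasePow k v := by
  simp only [phasePow, norm_mul, hμ, one_mul, mul_div_assoc, mul_zpow]
  ring

theorem phasePow_smul (k : ℤ) {t : ℝ} (ht : 0 < t) (v : ℂ) :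
    phasePow k (t • v) = t * phasePow k v := by
  have h0 : (t : ℂ) ≠ 0 := by exact_mod_cast ht.ne'
  rw [phasePow, phasePow, norm_smul, Real.norm_eq_abs, abs_of_pos ht, Complex.real_smul,
    Complex.ofReal_mul, mul_div_mul_left _ _ h0, mul_assoc]

theorem phasePow_ofReal (k : ℤ) {t : ℝ} (ht : 0 < t) : phasePow k (t : ℂ) = t := by
  have h0 : (t : ℂ) ≠ 0 := by exact_mod_cast ht.ne'
  simp [phasePow, abs_of_pos ht, h0]

/-- `C` bounds the second order deviation of `phasePow k` from its derivative at `1`. -/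
def IsPhaseBound (k : ℤ) (C : ℝ) : Prop :=
  1 ≤ C ∧ ∀ v : ℂ, ‖phasePow k v - (v.re + k * v.im * Complex.I)‖ ≤ C * (‖v‖ - v.re)

theorem exists_isPhaseBound (k : ℤ) : ∃ C, IsPhaseBound k C := by
  obtain ⟨C, hC, h⟩ := exists_norm_zpow_sub_le k
  refine ⟨C, hC, fun v => ?_⟩
  rcases eq_or_ne v 0 with rfl | hv
  · simp [phasePow]
  · have hn : 0 < ‖v‖ := norm_pos_iff.2 hv
    have hn' : (‖v‖ : ℂ) ≠ 0 := by exact_mod_cast hn.ne'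
    have hre : (v / ‖v‖).re = v.re / ‖v‖ := Complex.div_ofReal_re v _
    have him : (v / ‖v‖).im = v.im / ‖v‖ := Complex.div_ofReal_im v _
    have h1 := h (v / ‖v‖) (by simp [hn.ne'])
    rw [hre, him] at h1
    have e : phasePow k v - (v.re + k * v.im * Complex.I) = ‖v‖ * ((v / ‖v‖) ^ k -
        ((v.re / ‖v‖ : ℝ) + k * (v.im / ‖v‖ : ℝ) * Complex.I)) := by
      rw [phasePow]; push_cast; field_simp
    rw [e, norm_mul, Complex.norm_real, norm_norm]
    calc _ ≤ ‖v‖ * (C * (1 - v.re / ‖v‖)) := by gcongr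
      _ = C * (‖v‖ - v.re) := by field_simp

/-! ### Sublinear functions on `ℂ` and their linear minorants. -/

/-- Positively homogeneous and subadditive functions on `ℂ`. -/
structure IsSublinear (f : ℂ → ℝ) : Prop where
  smul : ∀ t : ℝ, 0 < t → ∀ v, f (t • v) = t * f v
  add : ∀ u v, f (u + v) ≤ f u + f v

theorem IsSublinear.map_zero {f : ℂ → ℝ} (hf : IsSublinear f) : f 0 = 0 := by
  have := hf.smul 2 two_pos 0
  rw [smul_zero] at this
  linarith

theorem isSublinear_const_mul_norm {t : ℝ} (ht : 0 ≤ t) :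
    IsSublinear fun v : ℂ => t * ‖v‖ where
  smul s hs v := by
    rw [norm_smul, Real.norm_eq_abs, abs_of_pos hs]; ring
  add u v := by
    rw [← mul_add]; exact mul_le_mul_of_nonneg_left (norm_add_le u v) ht

theorem IsSublinear.fun_add {f g : ℂ → ℝ} (hf : IsSublinear f) (hg : IsSublinear g) :
    IsSublinear fun v => f v + g v where
  smul t ht v := by rw [hf.smul t ht, hg.smul t ht]; ring
  add u v := by linarith [hf.add u v, hg.add u v]

/-- The real-linear functionals on `ℂ` dominated by `f`. -/
def minorants (f : ℂ → ℝ) : Set (ℂ →ₗ[ℝ] ℝ) := {l | ∀ v, l v ≤ f v}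

theorem minorants_nonempty {f : ℂ → ℝ} (hf : IsSublinear f) : (minorants f).Nonempty := by
  obtain ⟨l, -, hl⟩ := exists_extension_of_le_sublinear ⟨⊥, 0⟩ f hf.smul hf.add (by
    rintro ⟨x, hx⟩
    rw [Submodule.mem_bot] at hx
    subst hx
    exact hf.map_zero.ge)
  exact ⟨l, hl⟩

/-- A functional dominated by a sum of sublinear functions splits accordingly. -/
theorem exists_add_of_mem_minorants {f g : ℂ → ℝ} (hf : IsSublinear f) (hg : IsSublinear g)
    {l : ℂ →ₗ[ℝ] ℝ} (hl : l ∈ minorants fun v => f v + g v) :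
    ∃ a ∈ minorants f, ∃ b ∈ minorants g, a + b = l := by
  -- Hahn–Banach on `ℂ × ℂ`: `l` lives on the diagonal, and the extension restricted to the two axes
  -- gives the summands.
  let D : Submodule ℝ (ℂ × ℂ) := LinearMap.range (LinearMap.prod LinearMap.id LinearMap.id)
  obtain ⟨m, hm, hm'⟩ := exists_extension_of_le_sublinear
    ⟨D, (l.comp (LinearMap.fst ℝ ℂ ℂ)).comp D.subtype⟩ (fun p : ℂ × ℂ => f p.1 + g p.2)
    (fun c hc x => by
      simp only [Prod.smul_fst, Prod.smul_snd, hf.smul c hc, hg.smul c hc]; ring)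
    (fun x y => by
      simp only [Prod.fst_add, Prod.snd_add]
      linarith [hf.add x.1 y.1, hg.add x.2 y.2])
    (by
      rintro ⟨_, v, rfl⟩
      exact hl v)
  refine ⟨m.comp (LinearMap.inl ℝ ℂ ℂ), fun v => ?_, m.comp (LinearMap.inr ℝ ℂ ℂ), fun v => ?_, ?_⟩
  · simpa [hg.map_zero] using hm' (v, 0)
  · simpa [hf.map_zero] using hm' (0, v)
  · refine LinearMap.ext fun v => ?_
    have := hm ⟨(v, v), v, rfl⟩
    simp only [LinearMap.add_apply, LinearMap.comp_apply, LinearMap.inl_apply,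
      LinearMap.inr_apply, ← map_add, Prod.mk_add_mk, add_zero, zero_add]
    exact this

/-! ### Convexity of the corrected phase power. -/

/-- `C|c||v| + Re (c |v| (v / |v|) ^ k)`. -/
noncomputable def phaseFun (C : ℝ) (k : ℤ) (c v : ℂ) : ℝ :=
  C * ‖c‖ * ‖v‖ + (c * phasePow k v).re

theorem phaseFun_mul (C : ℝ) (k : ℤ) (c : ℂ) {μ : ℂ} (hμ : ‖μ‖ = 1) (v : ℂ) :
    phaseFun C k c (μ * v) = phaseFun C k (c * μ ^ k) v := by
  simp [phaseFun, phasePow_mul k hμ, hμ, norm_zpow, mul_assoc]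

theorem phaseFun_le (C : ℝ) (k : ℤ) (c v : ℂ) : phaseFun C k c v ≤ (C + 1) * ‖c‖ * ‖v‖ := by
  have h1 : (c * phasePow k v).re ≤ ‖c‖ * ‖v‖ := by
    refine (Complex.re_le_norm _).trans ?_
    rw [norm_mul]
    exact mul_le_mul_of_nonneg_left (norm_phasePow_le k v) (norm_nonneg c)
  unfold phaseFun
  linarith

theorem phaseFun_nonneg {C : ℝ} (hC : 1 ≤ C) (k : ℤ) (c v : ℂ) : 0 ≤ phaseFun C k c v := by
  have h1 : -(c * phasePow k v).re ≤ ‖c‖ * ‖v‖ := by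
    refine (neg_le_abs _).trans ((Complex.abs_re_le_norm _).trans ?_)
    rw [norm_mul]
    exact mul_le_mul_of_nonneg_left (norm_phasePow_le k v) (norm_nonneg c)
  have h2 : ‖c‖ * ‖v‖ ≤ C * ‖c‖ * ‖v‖ := by
    rw [mul_assoc]
    exact le_mul_of_one_le_left (by positivity) hC
  unfold phaseFun
  linarith

/-- The left side is the tangent functional at `v = 1`, exact on the positive reals; the phase bound
says that `C‖c‖‖v‖` absorbs the second order error. -/
theorem IsPhaseBound.tangent_le {k : ℤ} {C : ℝ} (h : IsPhaseBound k C) (c v : ℂ) :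
    (C * ‖c‖ + c.re) * v.re - k * c.im * v.im ≤ phaseFun C k c v := by
  have h1 := (neg_le_abs _).trans ((Complex.abs_re_le_norm
    (c * (phasePow k v - (v.re + k * v.im * Complex.I)))).trans (norm_mul_le _ _))
  have h2 := mul_le_mul_of_nonneg_left (h.2 v) (norm_nonneg c)
  have e : (c * (phasePow k v - (v.re + k * v.im * Complex.I))).re
      = (c * phasePow k v).re - (c.re * v.re - k * c.im * v.im) := by
    simp [Complex.mul_re]; ring
  rw [e] at h1
  unfold phaseFun
  nlinarith

/-- By rotation there is a supporting functional in every direction. The one in the direction of `u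
+ v`, applied to `u` and `v` separately, gives subadditivity. -/
theorem IsPhaseBound.isSublinear {k : ℤ} {C : ℝ} (h : IsPhaseBound k C) (c : ℂ) :
    IsSublinear (phaseFun C k c) where
  smul t ht v := by
    have e : (c * (t * phasePow k v)).re = t * (c * phasePow k v).re := by
      rw [mul_left_comm, Complex.re_ofReal_mul]
    rw [phaseFun, phasePow_smul k ht, e, norm_smul, Real.norm_eq_abs, abs_of_pos ht, phaseFun]
    ring
  add u v := by
    rcases eq_or_ne (u + v) 0 with h0 | h0
    · rw [h0]
      have : phaseFun C k c 0 = 0 := by simp [phaseFun, phasePow]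
      rw [this]
      exact add_nonneg (phaseFun_nonneg h.1 k c u) (phaseFun_nonneg h.1 k c v)
    · have hn : 0 < ‖u + v‖ := norm_pos_iff.2 h0
      have hn' : (‖u + v‖ : ℂ) ≠ 0 := by exact_mod_cast hn.ne'
      set ζ : ℂ := (u + v) / ‖u + v‖ with hζ
      have hζ1 : ‖ζ‖ = 1 := by simp [hζ, hn.ne']
      have hζ0 : ζ ≠ 0 := norm_ne_zero_iff.1 (by rw [hζ1]; exact one_ne_zero)
      have rot : ∀ w, phaseFun C k c w = phaseFun C k (c * ζ ^ k) (ζ⁻¹ * w) := fun w => by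
        rw [← phaseFun_mul C k c hζ1, mul_inv_cancel_left₀ hζ0]
      have hsum : ζ⁻¹ * (u + v) = (‖u + v‖ : ℝ) := by
        rw [hζ]; field_simp
      set d := c * ζ ^ k
      rw [rot (u + v), rot u, rot v, hsum]
      refine le_trans (le_of_eq ?_)
        (add_le_add (h.tangent_le d (ζ⁻¹ * u)) (h.tangent_le d (ζ⁻¹ * v)))
      have hre : (ζ⁻¹ * u).re + (ζ⁻¹ * v).re = ‖u + v‖ := by
        rw [← Complex.add_re, ← mul_add, hsum, Complex.ofReal_re]
      have him : (ζ⁻¹ * u).im + (ζ⁻¹ * v).im = 0 := by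
        rw [← Complex.add_im, ← mul_add, hsum, Complex.ofReal_im]
      rw [phaseFun, phasePow_ofReal k hn, Complex.norm_real, norm_norm, Complex.re_mul_ofReal]
      linear_combination (-(C * ‖d‖ + d.re)) * hre + (k * d.im) * him

namespace Complexification

/-! ### Sublinear functions of an element of a complex Banach lattice -/

section SublinearCalculus

variable {E : Type*} [NormedAddCommGroup E] [Lattice E] [HasSolidNorm E] [IsOrderedAddMonoid E]
  [NormedSpace ℝ E] [IsOrderedModule ℝ E]

/-- In a Banach lattice, a set which up to small multiples of some `u` is dominated by finite
subsets has a supremum. -/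
theorem exists_isLUB_of_finset_approx [CompleteSpace E] {A : Set E} {u : E} (hu : 0 ≤ u)
    (h : ∀ ε : ℝ, 0 < ε → ∃ s ∈ lowerBounds (upperBounds A), ∀ a ∈ A, a ≤ s + ε • u) :
    ∃ m, IsLUB A m := by
  have hd : ∀ N : ℕ, (0 : ℝ) < 1 / (N + 1) := fun N => by positivity
  choose s hs hs' using fun N : ℕ => h (1 / (N + 1)) (hd N)
  have hlim := tendsto_one_div_add_atTop_nhds_zero_nat (𝕜 := ℝ)
  -- Each `s N + u / (N + 1)` is an upper bound of `A`, and each `s M` lies below all upper bounds;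
  -- hence `s` is Cauchy.
  have hle : ∀ M N, s M ≤ s N + (1 / (N + 1) : ℝ) • u := fun M N =>
    hs M fun a ha => hs' N a ha
  have hcau : CauchySeq s := by
    refine cauchySeq_of_le_tendsto_0 (fun N : ℕ => (1 / (N + 1) : ℝ) * ‖u‖) ?_
      (by simpa using hlim.mul_const ‖u‖)
    intro n m N hn hm
    rw [dist_eq_norm, ← abs_of_nonneg (hd N).le, ← Real.norm_eq_abs, ← norm_smul]
    apply norm_le_norm_of_abs_le_abs
    rw [abs_of_nonneg (smul_nonneg (hd N).le hu)]
    refine abs_le'.2 ⟨?_, ?_⟩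
    · rw [sub_le_iff_le_add']
      exact (hle n m).trans (by gcongr)
    · rw [neg_sub, sub_le_iff_le_add']
      exact (hle m n).trans (by gcongr)
  obtain ⟨m, hm⟩ := cauchySeq_tendsto_of_complete hcau
  refine ⟨m, fun a ha => ?_, fun b hb => le_of_tendsto' hm fun N => hs N hb⟩
  have : Tendsto (fun N : ℕ => s N + (1 / (N + 1) : ℝ) • u) atTop (𝓝 m) := by
    simpa using hm.add (hlim.smul_const u)
  exact ge_of_tendsto' this fun N => hs' N a ha

/-- The value at `z = x + iy` of the `E`-valued extension of a real functional on `ℂ`. -/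
noncomputable def realEval (l : ℂ →ₗ[ℝ] ℝ) (z : Complexification E) : E :=
  l 1 • z.re + l Complex.I • z.im

theorem apply_eq_re_im (l : ℂ →ₗ[ℝ] ℝ) (c : ℂ) : l c = c.re * l 1 + c.im * l Complex.I := by
  have e : c = c.re • 1 + c.im • Complex.I := by
    rw [Complex.real_smul, Complex.real_smul, mul_one, Complex.re_add_im]
  conv_lhs => rw [e]
  rw [map_add, map_smul, map_smul, smul_eq_mul, smul_eq_mul]

theorem realEval_add_left (l m : ℂ →ₗ[ℝ] ℝ) (z : Complexification E) :
    realEval (l + m) z = realEval l z + realEval m z := by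
  simp only [realEval, LinearMap.add_apply]; module

theorem realEval_add_right (l : ℂ →ₗ[ℝ] ℝ) (z w : Complexification E) :
    realEval l (z + w) = realEval l z + realEval l w := by
  simp only [realEval, add_re, add_im]; module

theorem realEval_smul_right (l : ℂ →ₗ[ℝ] ℝ) (c : ℂ) (z : Complexification E) :
    realEval l (c • z) = realEval (l.comp (LinearMap.mulLeft ℝ c)) z := by
  simp only [realEval, LinearMap.comp_apply, LinearMap.mulLeft_apply]
  rw [apply_eq_re_im l (c * 1), apply_eq_re_im l (c * Complex.I)]
  simp only [smul_re, smul_im, mul_one, Complex.mul_re, Complex.mul_im, Complex.I_re,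
    Complex.I_im, mul_zero]
  module

/-- Minorants correspond to the pairs `(l 1, l I)` in a bounded box of the plane, so a finite
`ε`-net of them is optimal up to `ε (|re z| + |im z|)`. -/
theorem exists_isLUB_realEval [CompleteSpace E] {f : ℂ → ℝ} (hf : IsSublinear f)
    (z : Complexification E) : ∃ m, IsLUB ((fun l => realEval l z) '' minorants f) m := by
  have hu : (0 : E) ≤ |z.re| + |z.im| := add_nonneg (abs_nonneg _) (abs_nonneg _)
  refine exists_isLUB_of_finset_approx hu fun ε hε => ?_
  let φ : (ℂ →ₗ[ℝ] ℝ) → ℝ × ℝ := fun l => (l 1, l Complex.I)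
  have htb : TotallyBounded (φ '' minorants f) := by
    refine (isCompact_Icc (a := ((-f (-1), -f (-Complex.I)) : ℝ × ℝ))
      (b := (f 1, f Complex.I))).totallyBounded.subset ?_
    rintro _ ⟨l, hl, rfl⟩
    have h1 := hl (-1)
    have h2 := hl (-Complex.I)
    rw [map_neg] at h1 h2
    exact ⟨⟨by simp only [φ]; linarith, by simp only [φ]; linarith⟩, hl 1, hl Complex.I⟩
  obtain ⟨t, ht, hfin, hcov⟩ := Metric.finite_approx_of_totallyBounded htb ε hε
  obtain ⟨l₀, hl₀⟩ := minorants_nonempty hf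
  have hne : hfin.toFinset.Nonempty := by
    obtain ⟨y, hy, -⟩ := Set.mem_iUnion₂.1 (hcov ⟨l₀, hl₀, rfl⟩)
    exact ⟨y, hfin.mem_toFinset.2 hy⟩
  refine ⟨hfin.toFinset.sup' hne fun p => p.1 • z.re + p.2 • z.im, ?_, ?_⟩
  · intro b hb
    refine Finset.sup'_le _ _ fun p hp => ?_
    obtain ⟨l, hl, rfl⟩ := ht (hfin.mem_toFinset.1 hp)
    exact hb ⟨l, hl, rfl⟩
  · rintro _ ⟨l, hl, rfl⟩
    obtain ⟨p, hp, hlp⟩ := Set.mem_iUnion₂.1 (hcov ⟨l, hl, rfl⟩)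
    rw [Metric.mem_ball, Prod.dist_eq, max_lt_iff, Real.dist_eq, Real.dist_eq] at hlp
    have e : realEval l z = (p.1 • z.re + p.2 • z.im) +
        ((l 1 - p.1) • z.re + (l Complex.I - p.2) • z.im) := by
      simp only [realEval]; module
    simp only [e, smul_add]
    gcongr
    · exact Finset.le_sup' (fun p : ℝ × ℝ => p.1 • z.re + p.2 • z.im) (hfin.mem_toFinset.2 hp)
    · exact (smul_le_abs_smul_abs _ _).trans
        (smul_le_smul_of_nonneg_right hlp.1.le (abs_nonneg _))
    · exact (smul_le_abs_smul_abs _ _).trans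
        (smul_le_smul_of_nonneg_right hlp.2.le (abs_nonneg _))

/-- The value `f(z)` of a sublinear function `f : ℂ → ℝ` at an element `z` of a complex Banach
lattice, as the supremum of the values of its linear minorants. -/
noncomputable def supEval (f : ℂ → ℝ) (z : Complexification E) : E :=
  Classical.epsilon (IsLUB ((fun l => realEval l z) '' minorants f))

variable [CompleteSpace E]

theorem isLUB_supEval {f : ℂ → ℝ} (hf : IsSublinear f) (z : Complexification E) :
    IsLUB ((fun l => realEval l z) '' minorants f) (supEval f z) :=
  Classical.epsilon_spec (exists_isLUB_realEval hf z)

theorem realEval_le_supEval {f : ℂ → ℝ} (hf : IsSublinear f) {l : ℂ →ₗ[ℝ] ℝ}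
    (hl : l ∈ minorants f) (z : Complexification E) : realEval l z ≤ supEval f z :=
  (isLUB_supEval hf z).1 ⟨l, hl, rfl⟩

theorem supEval_le {f : ℂ → ℝ} (hf : IsSublinear f) {z : Complexification E} {b : E}
    (h : ∀ l ∈ minorants f, realEval l z ≤ b) : supEval f z ≤ b :=
  (isLUB_supEval hf z).2 (by rintro _ ⟨l, hl, rfl⟩; exact h l hl)

theorem supEval_mono {f g : ℂ → ℝ} (hf : IsSublinear f) (hg : IsSublinear g)
    (h : ∀ v, f v ≤ g v) (z : Complexification E) : supEval f z ≤ supEval g z :=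
  supEval_le hf fun _ hl => realEval_le_supEval hg (fun v => (hl v).trans (h v)) z

/-- The inequality `≤` rests on splitting minorants of a sum. Additivity is what lets identities
between sublinear functions pass to the lattice. -/
theorem supEval_add {f g : ℂ → ℝ} (hf : IsSublinear f) (hg : IsSublinear g)
    (z : Complexification E) :
    supEval (fun v => f v + g v) z = supEval f z + supEval g z := by
  refine le_antisymm (supEval_le (hf.fun_add hg) fun l hl => ?_)
    (((isLUB_supEval hf z).add (isLUB_supEval hg z)).2 ?_)
  · obtain ⟨a, ha, b, hb, rfl⟩ := exists_add_of_mem_minorants hf hg hl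
    rw [realEval_add_left]
    exact add_le_add (realEval_le_supEval hf ha z) (realEval_le_supEval hg hb z)
  · rintro _ ⟨_, ⟨a, ha, rfl⟩, _, ⟨b, hb, rfl⟩, rfl⟩
    simp only [← realEval_add_left]
    exact realEval_le_supEval (hf.fun_add hg) (fun v => add_le_add (ha v) (hb v)) z

theorem supEval_const_mul {f : ℂ → ℝ} {t : ℝ} (ht : 0 < t) (hf : IsSublinear f)
    (hg : IsSublinear fun v => t * f v) (z : Complexification E) :
    supEval (fun v => t * f v) z = t • supEval f z := by
  have sc : ∀ (s : ℝ) (l : ℂ →ₗ[ℝ] ℝ), realEval (s • l) z = s • realEval l z := fun s l => by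
    simp only [realEval, LinearMap.smul_apply, smul_eq_mul]; module
  refine le_antisymm (supEval_le hg fun l hl => ?_) ?_
  · have : realEval (t⁻¹ • l) z ≤ supEval f z := realEval_le_supEval hf (fun v => by
      rw [LinearMap.smul_apply, smul_eq_mul, inv_mul_le_iff₀ ht]; exact hl v) z
    have := smul_le_smul_of_nonneg_left this ht.le
    rwa [sc, smul_inv_smul₀ ht.ne'] at this
  · have : supEval f z ≤ t⁻¹ • supEval (fun v => t * f v) z := supEval_le hf fun l hl => by
      have := realEval_le_supEval hg (l := t • l)
        (fun v => mul_le_mul_of_nonneg_left (hl v) ht.le) z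
      rw [sc] at this
      have := smul_le_smul_of_nonneg_left this (inv_pos.2 ht).le
      rwa [inv_smul_smul₀ ht.ne'] at this
    have := smul_le_smul_of_nonneg_left this ht.le
    rwa [smul_inv_smul₀ ht.ne'] at this

theorem supEval_smul_of_norm_eq_one {f g : ℂ → ℝ} (hf : IsSublinear f) (hg : IsSublinear g)
    {μ : ℂ} (hμ : ‖μ‖ = 1) (h : ∀ v, f (μ * v) = g v) (z : Complexification E) :
    supEval f (μ • z) = supEval g z := by
  have hμ0 : μ ≠ 0 := norm_ne_zero_iff.1 (by rw [hμ]; exact one_ne_zero)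
  refine le_antisymm (supEval_le hf fun l hl => ?_) (supEval_le hg fun l hl => ?_)
  · rw [realEval_smul_right]
    exact realEval_le_supEval hg (fun v => (hl (μ * v)).trans (h v).le) z
  · have hz : z = μ⁻¹ • μ • z := (inv_smul_smul₀ hμ0 z).symm
    rw [hz, realEval_smul_right, ← hz]
    refine realEval_le_supEval hf (fun v => (hl (μ⁻¹ * v)).trans ?_) (μ • z)
    rw [← h, mul_inv_cancel_left₀ hμ0]

/-- `rotRe · θ` is the evaluation of `v ↦ Re (e^{-iθ} v)`. -/
theorem exists_realEval_eq_rotRe (t θ : ℝ) (ht : 0 ≤ t) :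
    ∃ l ∈ minorants fun v => t * ‖v‖, ∀ z : Complexification E, realEval l z = t • rotRe z θ := by
  refine ⟨t • (Complex.reLm.comp (LinearMap.mulLeft ℝ (Complex.exp (-θ * Complex.I)))),
    fun v => ?_, fun z => ?_⟩
  · rw [LinearMap.smul_apply, smul_eq_mul]
    refine mul_le_mul_of_nonneg_left ((Complex.re_le_norm _).trans ?_) ht
    rw [LinearMap.mulLeft_apply, norm_mul]
    have := Complex.norm_exp_ofReal_mul_I (-θ)
    rw [Complex.ofReal_neg] at this
    rw [this, one_mul]
  · have e : Complex.exp (-θ * Complex.I) = ⟨Real.cos θ, -Real.sin θ⟩ := by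
      have := Complex.exp_ofReal_mul_I_re (-θ)
      have h2 := Complex.exp_ofReal_mul_I_im (-θ)
      rw [Complex.ofReal_neg] at this h2
      rw [Real.cos_neg] at this
      rw [Real.sin_neg] at h2
      exact Complex.ext this h2
    rw [e]
    simp only [realEval, rotRe, LinearMap.smul_apply, LinearMap.comp_apply,
      LinearMap.mulLeft_apply, Complex.reLm_coe, Complex.mul_re, Complex.one_re, Complex.one_im,
      Complex.I_re, Complex.I_im, smul_eq_mul]
    module

theorem realEval_le_smul_modulus {t : ℝ} {l : ℂ →ₗ[ℝ] ℝ}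
    (hl : l ∈ minorants fun v => t * ‖v‖) (z : Complexification E) :
    realEval l z ≤ t • modulus z := by
  -- `p` represents `l` as a real inner product; testing `l` at `p` itself gives `‖p‖ ≤ t`.
  set p : ℂ := ⟨l 1, l Complex.I⟩ with hp
  have hpn : ‖p‖ ≤ t := by
    have h1 := hl p
    rw [apply_eq_re_im] at h1
    have h2 : p.re * l 1 + p.im * l Complex.I = ‖p‖ * ‖p‖ := by
      rw [← pow_two ‖p‖, ← Complex.normSq_eq_norm_sq, Complex.normSq_apply]
    rw [h2] at h1
    rcases (norm_nonneg p).eq_or_lt with h0 | h0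
    · have := hl 1
      have h3 := hl (-1)
      rw [map_neg] at h3
      simp only [norm_neg, norm_one] at this h3
      linarith
    · exact le_of_mul_le_mul_right h1 h0
  have e : realEval l z = ‖p‖ • rotRe z p.arg := by
    have hre : ‖p‖ * Real.cos p.arg = l 1 := Complex.norm_mul_cos_arg p
    have him : ‖p‖ * Real.sin p.arg = l Complex.I := Complex.norm_mul_sin_arg p
    simp only [realEval, rotRe, ← hre, ← him]
    module
  rw [e]
  exact (smul_le_smul_of_nonneg_left (rotRe_le_modulus z _) (norm_nonneg p)).trans
    (smul_le_smul_of_nonneg_right hpn (modulus_nonneg z))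

theorem supEval_const_mul_norm {t : ℝ} (ht : 0 ≤ t) (z : Complexification E) :
    supEval (fun v => t * ‖v‖) z = t • modulus z := by
  have hs := isSublinear_const_mul_norm ht
  refine le_antisymm (supEval_le hs fun l hl => realEval_le_smul_modulus hl z) ?_
  rcases ht.eq_or_lt with rfl | h0
  · rw [zero_smul]
    have := realEval_le_supEval hs (l := 0) (fun v => by simp) z
    simpa [realEval] using this
  · have : modulus z ≤ t⁻¹ • supEval (fun v => t * ‖v‖) z := modulus_le fun θ => by
      obtain ⟨l, hl, h⟩ := exists_realEval_eq_rotRe (E := E) t θ ht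
      have := realEval_le_supEval hs hl z
      rw [h] at this
      have := smul_le_smul_of_nonneg_left this (inv_pos.2 h0).le
      rwa [inv_smul_smul₀ h0.ne'] at this
    have := smul_le_smul_of_nonneg_left this ht
    rwa [smul_inv_smul₀ h0.ne'] at this

theorem supEval_add_le {f : ℂ → ℝ} (hf : IsSublinear f) {t : ℝ} (hft : ∀ v, f v ≤ t * ‖v‖)
    (z w : Complexification E) : supEval f (z + w) ≤ supEval f z + t • modulus w := by
  refine supEval_le hf fun l hl => ?_
  rw [realEval_add_right]
  exact add_le_add (realEval_le_supEval hf hl z)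
    (realEval_le_smul_modulus (fun v => (hl v).trans (hft v)) w)

/-! ### Phase powers of a lattice element. -/

/-- The element `w = |z| (z / |z|) ^ k`, characterised through its real functionals. -/
theorem exists_phasePow {k : ℤ} {C : ℝ} (h : IsPhaseBound k C) (z : Complexification E) :
    ∃ w : Complexification E, ∀ c : ℂ,
      (c • w).re + (C * ‖c‖) • modulus z = supEval (phaseFun C k c) z := by
  have hC : 0 ≤ C := zero_le_one.trans h.1
  set G : ℂ → E := fun c => supEval (phaseFun C k c) z - (C * ‖c‖) • modulus z with hG
  have add : ∀ c d, G (c + d) = G c + G d := fun c d => by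
    -- `F_c + F_d` exceeds `F_(c+d)` by this multiple of the norm. As the multiple is nonnegative,
    -- both sides are sums of sublinear functions.
    have hn : 0 ≤ C * (‖c‖ + ‖d‖ - ‖c + d‖) := mul_nonneg hC (by linarith [norm_add_le c d])
    have e1 := supEval_add (h.isSublinear c) (h.isSublinear d) z
    have e2 := supEval_add (h.isSublinear (c + d)) (isSublinear_const_mul_norm hn) z
    have e3 : (fun v => phaseFun C k c v + phaseFun C k d v) =
        fun v => phaseFun C k (c + d) v + C * (‖c‖ + ‖d‖ - ‖c + d‖) * ‖v‖ := by
      funext v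
      simp only [phaseFun, add_mul, Complex.add_re]
      ring
    rw [← e3, e1, supEval_const_mul_norm hn] at e2
    simp only [hG]
    rw [eq_sub_of_add_eq e2.symm]
    module
  have smul : ∀ t : ℝ, 0 < t → ∀ c, G (t * c) = t • G c := fun t ht c => by
    have e : (fun v => t * phaseFun C k c v) = phaseFun C k (t * c) := by
      funext v
      simp only [phaseFun, norm_mul, Complex.norm_real, Real.norm_eq_abs, abs_of_pos ht,
        mul_assoc, Complex.re_ofReal_mul]
      ring
    have := supEval_const_mul ht (h.isSublinear c) (by rw [e]; exact h.isSublinear _) z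
    rw [e] at this
    simp only [hG, this, norm_mul, Complex.norm_real, Real.norm_eq_abs, abs_of_pos ht]
    module
  have zero : G 0 = 0 := by simpa using add 0 0
  have neg : ∀ c, G (-c) = -G c := fun c => by
    rw [eq_neg_iff_add_eq_zero, ← add, neg_add_cancel, zero]
  have smul' : ∀ (t : ℝ) (c : ℂ), G (t * c) = t • G c := fun t c => by
    rcases lt_trichotomy t 0 with ht | rfl | ht
    · have := smul (-t) (neg_pos.2 ht) c
      rw [Complex.ofReal_neg, neg_mul, neg] at this
      rw [← neg_neg (G _), this]; module
    · simp [zero]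
    · exact smul t ht c
  -- The sign comes from `Re(c w) = Re c Re w - Im c Im w`.
  refine ⟨⟨G 1, -G Complex.I⟩, fun c => ?_⟩
  have : G c = c.re • G 1 + c.im • G Complex.I := by
    rw [← smul', ← smul', ← add, mul_one, Complex.re_add_im]
  rw [smul_re, smul_neg, sub_neg_eq_add, ← this]
  exact sub_add_cancel _ _

theorem smul_re_le_modulus {c : ℂ} (hc : ‖c‖ = 1) (z : Complexification E) :
    (c • z).re ≤ modulus z := by
  have := ((le_abs_self _).trans (abs_re_le_modulus (c • z))).trans (modulus_smul_le c z)
  rwa [hc, one_smul] at this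

theorem modulus_le_of_smul_re_le {z : Complexification E} {b : E}
    (h : ∀ c : ℂ, ‖c‖ = 1 → (c • z).re ≤ b) : modulus z ≤ b := by
  refine modulus_le fun θ => ?_
  have := h ⟨Real.cos θ, -Real.sin θ⟩ (by
    rw [Complex.norm_def, Complex.normSq_apply]
    simp [← sq])
  simpa [rotRe] using this

/-- The tangent bound with coefficient 1, evaluated at `ζ • z`; rotating the argument by `ζ` turns
the coefficient into `ζ ^ k`. -/
theorem _root_.IsPhaseBound.le_supEval {k : ℤ} {C : ℝ} (h : IsPhaseBound k C) {ζ : ℂ} (hζ : ‖ζ‖ = 1)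
    (z : Complexification E) :
    (C + 1) • (ζ • z).re ≤ supEval (phaseFun C k (ζ ^ k)) z := by
  have h1 : (C + 1) • (ζ • z).re = realEval ((C + 1) • Complex.reLm) (ζ • z) := by
    simp [realEval]
  rw [h1, ← supEval_smul_of_norm_eq_one (h.isSublinear 1) (h.isSublinear _) hζ (fun v => by
    rw [phaseFun_mul C k 1 hζ, one_mul])]
  refine realEval_le_supEval (h.isSublinear 1) (fun v => ?_) _
  simpa using h.tangent_le 1 v

theorem modulus_le_of_phasePow {k : ℤ} {C : ℝ} (h : IsPhaseBound k C)
    {z w : Complexification E} (hw : ∀ c : ℂ,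
      (c • w).re + (C * ‖c‖) • modulus z = supEval (phaseFun C k c) z) :
    modulus w ≤ modulus z := by
  have hC : 0 ≤ C := zero_le_one.trans h.1
  refine modulus_le_of_smul_re_le fun c hc => ?_
  have h1 : supEval (phaseFun C k c) z ≤ (C + 1) • modulus z := by
    rw [← supEval_const_mul_norm (by linarith)]
    refine supEval_mono (h.isSublinear c) (isSublinear_const_mul_norm (by linarith)) ?_ z
    intro v
    have := phaseFun_le C k c v
    rwa [hc, mul_one] at this
  have h2 := hw c
  rw [hc, mul_one] at h2
  rw [← h2, add_smul, one_smul, add_comm] at h1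
  exact le_of_add_le_add_left h1

end SublinearCalculus

end Complexification

/-! ### Powers of an operator, null sequences and geometric sums. -/

theorem tendsto_pow_smul_sub_pow_apply {𝕜 X : Type*} [NontriviallyNormedField 𝕜]
    [NormedAddCommGroup X] [NormedSpace 𝕜 X] (T : X →L[𝕜] X) (μ : 𝕜) {x : ℕ → X}
    (h : Tendsto (fun n => μ • x n - T (x n)) atTop (𝓝 0)) (j : ℕ) :
    Tendsto (fun n => μ ^ j • x n - (T ^ j) (x n)) atTop (𝓝 0) := by
  induction j with
  | zero => simp
  | succ j ih =>
    have e : ∀ n, μ ^ (j + 1) • x n - (T ^ (j + 1)) (x n)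
        = (T ^ j) (μ • x n - T (x n)) + μ • (μ ^ j • x n - (T ^ j) (x n)) := fun n => by
      rw [pow_succ T, mul_apply_eq_comp, map_sub, map_smul, smul_sub, smul_smul,
        pow_succ' μ]
      abel
    simp only [e]
    simpa using (((T ^ j).continuous.tendsto 0).comp h).add (ih.const_smul μ)

/-- Since `δ` may depend on `ε`, an iteration count can be fixed from `ε` before `n` tends to
infinity. -/
theorem tendsto_zero_of_norm_le_add {X : Type*} [SeminormedAddCommGroup X] {u : ℕ → X}
    (h : ∀ ε : ℝ, 0 < ε → ∃ δ : ℕ → ℝ, Tendsto δ atTop (𝓝 0) ∧ ∀ᶠ n in atTop, ‖u n‖ ≤ ε + δ n) :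
    Tendsto u atTop (𝓝 0) := by
  rw [NormedAddGroup.tendsto_nhds_zero]
  intro ε hε
  obtain ⟨δ, hδ, hu⟩ := h (ε / 2) (half_pos hε)
  filter_upwards [hu, hδ.eventually (gt_mem_nhds (half_pos hε))] with n h1 h2
  linarith

theorem smul_sum_pow_sub_apply {X : Type*} [NormedAddCommGroup X] [NormedSpace ℂ X]
    (T : X →L[ℂ] X) {c : ℂ} (hc : c ≠ 0) (w : X) (N : ℕ) :
    c • ∑ j ∈ Finset.range N, (c⁻¹) ^ j • (T ^ j) w
      - T (∑ j ∈ Finset.range N, (c⁻¹) ^ j • (T ^ j) w) = c • (w - (c⁻¹) ^ N • (T ^ N) w) := by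
  have h := Finset.sum_range_sub' (fun j => (c⁻¹) ^ j • (T ^ j) w) N
  simp only [pow_zero, one_apply_eq_self, one_smul] at h
  rw [← h, map_sum, Finset.smul_sum, Finset.smul_sum, ← Finset.sum_sub_distrib]
  refine Finset.sum_congr rfl fun j _ => ?_
  rw [smul_sub, map_smul, smul_smul c (c⁻¹ ^ (j + 1)), pow_succ' c⁻¹, mul_inv_cancel_left₀ hc,
    pow_succ' T, mul_apply_eq_comp]

/-! ### Positive operators and the phase inequality. -/

namespace Complexification

section PositiveOperator

variable {E : Type*} [NormedAddCommGroup E] [Lattice E] [HasSolidNorm E] [IsOrderedAddMonoid E]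
  [NormedSpace ℝ E] [IsOrderedModule ℝ E] [CompleteSpace E]

/-- `T (x + iy) = A x + i A y`. -/
def IsComplexExtension (T : Complexification E →L[ℂ] Complexification E) (A : E →L[ℝ] E) : Prop :=
  ∀ z, T z = ⟨A z.re, A z.im⟩

variable {T : Complexification E →L[ℂ] Complexification E} {A : E →L[ℝ] E}

theorem IsComplexExtension.pow (hT : IsComplexExtension T A) (j : ℕ) :
    IsComplexExtension (T ^ j) (A ^ j) := by
  induction j with
  | zero => exact fun z => rfl
  | succ j ih =>
    intro z
    rw [pow_succ', pow_succ', mul_apply_eq_comp, ih, hT]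
    rfl

theorem monotone_pow (hA : Monotone A) (j : ℕ) : Monotone (A ^ j : E →L[ℝ] E) := by
  induction j with
  | zero => exact monotone_id
  | succ j ih =>
    intro x y h
    rw [pow_succ', mul_apply_eq_comp, mul_apply_eq_comp]
    exact hA (ih h)

theorem IsComplexExtension.realEval_apply (hT : IsComplexExtension T A) (l : ℂ →ₗ[ℝ] ℝ)
    (z : Complexification E) : realEval l (T z) = A (realEval l z) := by
  simp [hT z, realEval]

theorem IsComplexExtension.supEval_apply_le (hT : IsComplexExtension T A) (hA : Monotone A)
    {f : ℂ → ℝ} (hf : IsSublinear f) (z : Complexification E) :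
    supEval f (T z) ≤ A (supEval f z) :=
  supEval_le hf fun l hl => by
    rw [hT.realEval_apply]; exact hA (realEval_le_supEval hf hl z)

theorem IsComplexExtension.modulus_apply_le (hT : IsComplexExtension T A) (hA : Monotone A)
    (z : Complexification E) : modulus (T z) ≤ A (modulus z) := by
  refine modulus_le fun θ => ?_
  have : rotRe (T z) θ = A (rotRe z θ) := by simp [hT z, rotRe]
  rw [this]
  exact hA (rotRe_le_modulus z θ)

/-- Writing `F_c(z) = F_d(μz)` with `d = c μ^(-k)`, replace `μz` by `Tz` at a cost of `C + 1` times
the modulus of the difference, then use `F_d(Tz) ≤ A F_d(z)`. -/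
theorem supEval_phaseFun_le {k : ℤ} {C : ℝ} (h : IsPhaseBound k C)
    (hT : IsComplexExtension T A) (hA : Monotone A) {μ c : ℂ} (hμ : ‖μ‖ = 1) (hc : ‖c‖ = 1)
    {z w : Complexification E} (hw : ∀ c : ℂ,
      (c • w).re + (C * ‖c‖) • modulus z = supEval (phaseFun C k c) z) :
    supEval (phaseFun C k c) z ≤ (c • (μ ^ k)⁻¹ • T w).re + (C • A (modulus z)
      + (C + 1) • modulus (μ • z - T z)) := by
  have hμ0 : μ ^ k ≠ 0 := zpow_ne_zero _ (norm_ne_zero_iff.1 (by rw [hμ]; exact one_ne_zero))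
  set d := c * (μ ^ k)⁻¹ with hd
  have hd1 : ‖d‖ = 1 := by simp [hd, hc, hμ, norm_zpow]
  have e : supEval (phaseFun C k c) z = supEval (phaseFun C k d) (T z + (μ • z - T z)) := by
    rw [add_sub_cancel, supEval_smul_of_norm_eq_one (h.isSublinear d) (h.isSublinear c) hμ]
    intro v
    rw [phaseFun_mul C k d hμ, hd, inv_mul_cancel_right₀ hμ0]
  rw [e, ← add_assoc]
  refine (supEval_add_le (h.isSublinear d) (t := C + 1) (fun v => ?_) _ _).trans ?_
  · simpa [hd1] using phaseFun_le C k d v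
  · gcongr
    refine (hT.supEval_apply_le hA (h.isSublinear d) z).trans (le_of_eq ?_)
    rw [← hw d, hd1, mul_one, map_add, map_smul, smul_smul, ← hd, ← map_smul T, hT]

/-- The one-step inequality applies to each `T ^ j` with `μ ^ j`. The coefficient `ζ ^ k` does not
depend on `j`, so the terms in `w` add up before the supremum over `ζ` is taken. -/
theorem smul_modulus_le {k : ℤ} {C : ℝ} (h : IsPhaseBound k C)
    (hT : IsComplexExtension T A) (hA : Monotone A) {μ : ℂ} (hμ : ‖μ‖ = 1)
    {z w : Complexification E} (hw : ∀ c : ℂ,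
      (c • w).re + (C * ‖c‖) • modulus z = supEval (phaseFun C k c) z) (N : ℕ) :
    (N * (C + 1)) • modulus z
      ≤ modulus (∑ j ∈ Finset.range N, ((μ ^ k)⁻¹) ^ j • (T ^ j) w)
        + ∑ j ∈ Finset.range N, (C • (A ^ j) (modulus z)
          + (C + 1) • modulus (μ ^ j • z - (T ^ j) z)) := by
  have hC : 0 < C + 1 := by linarith [h.1]
  rcases N.eq_zero_or_pos with rfl | hN
  · simpa using modulus_nonneg _
  have hN' : (0 : ℝ) < N := by exact_mod_cast hN
  have ht : 0 < N * (C + 1) := mul_pos hN' hC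
  rw [← le_inv_smul_iff_of_pos ht]
  refine modulus_le_of_smul_re_le fun ζ hζ => ?_
  rw [le_inv_smul_iff_of_pos ht, mul_smul]
  have hζk : ‖ζ ^ k‖ = 1 := by rw [norm_zpow, hζ, one_zpow]
  have step : ∀ j : ℕ, (C + 1) • (ζ • z).re ≤ (ζ ^ k • ((μ ^ k)⁻¹) ^ j • (T ^ j) w).re
      + (C • (A ^ j) (modulus z) + (C + 1) • modulus (μ ^ j • z - (T ^ j) z)) := fun j => by
    have hj : ‖μ ^ j‖ = 1 := by rw [norm_pow, hμ, one_pow]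
    have e : ((μ ^ k)⁻¹) ^ j = ((μ ^ j) ^ k)⁻¹ := by
      rw [inv_pow, ← zpow_natCast, ← zpow_natCast, zpow_comm]
    rw [e]
    exact (h.le_supEval hζ z).trans
      (supEval_phaseFun_le h (hT.pow j) (monotone_pow hA j) hj hζk hw)
  have hsum := Finset.sum_le_sum fun j (_ : j ∈ Finset.range N) => step j
  rw [Finset.sum_const, Finset.card_range, ← Nat.cast_smul_eq_nsmul ℝ,
    Finset.sum_add_distrib] at hsum
  refine hsum.trans ?_
  gcongr
  let reHom : Complexification E →+ E := ⟨⟨re, rfl⟩, fun _ _ => rfl⟩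
  have e : ∑ j ∈ Finset.range N, (ζ ^ k • ((μ ^ k)⁻¹) ^ j • (T ^ j) w).re
      = (ζ ^ k • ∑ j ∈ Finset.range N, ((μ ^ k)⁻¹) ^ j • (T ^ j) w).re := by
    rw [Finset.smul_sum]
    exact (map_sum reHom (fun j => ζ ^ k • ((μ ^ k)⁻¹) ^ j • (T ^ j) w) (Finset.range N)).symm
  rw [e]
  exact smul_re_le_modulus hζk _

/-- If `|z n| ≤ a x n` up to a null sequence and `μ ^ k` is not an approximate eigenvalue, then
the constant `a` can be improved by a fixed factor. -/
theorem exists_modulus_le_improved {k : ℤ} {C : ℝ} (h : IsPhaseBound k C)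
    (hT : IsComplexExtension T A) (hA : Monotone A) {μ : ℂ} (hμ : ‖μ‖ = 1) {M B : ℝ}
    (hM0 : 0 ≤ M) (hM : ∀ v, ‖v‖ ≤ M * ‖μ ^ k • v - T v‖)
    {z : ℕ → Complexification E} {x : ℕ → E} (hB : ∀ᶠ n in atTop, ‖x n‖ ≤ B)
    (hx : Tendsto (fun n => x n - A (x n)) atTop (𝓝 0))
    (hz : Tendsto (fun n => μ • z n - T (z n)) atTop (𝓝 0))
    (hzx : ∀ n, modulus (z n) ≤ x n) {a : ℝ}
    (ha : ∃ η : ℕ → E, Tendsto η atTop (𝓝 0) ∧ ∀ n, modulus (z n) ≤ a • x n + η n) :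
    ∃ η : ℕ → E, Tendsto η atTop (𝓝 0) ∧ ∀ n, modulus (z n) ≤ (C / (C + 1) * a) • x n + η n := by
  obtain ⟨η, hη, haη⟩ := ha
  have hC : 0 ≤ C := zero_le_one.trans h.1
  have hC1 : 0 < C + 1 := by linarith
  have hμ0 : μ ^ k ≠ 0 := zpow_ne_zero _ (norm_ne_zero_iff.1 (by rw [hμ]; exact one_ne_zero))
  have hμk : ‖μ ^ k‖ = 1 := by rw [norm_zpow, hμ, one_zpow]
  choose w hw using fun n => exists_phasePow h (z n)
  set b := C / (C + 1) * a with hb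
  have hxpow : ∀ j : ℕ, Tendsto (fun n => x n - (A ^ j) (x n)) atTop (𝓝 0) := fun j => by
    simpa using tendsto_pow_smul_sub_pow_apply A 1 (by simpa using hx) j
  have hzpow := tendsto_pow_smul_sub_pow_apply T μ hz
  -- The cost of replacing `A ^ j |z n|` by `a x n`, plus the eigenvector defects; null in `n` for
  -- fixed `N`.
  set err : ℕ → ℕ → E := fun N n => ∑ j ∈ Finset.range N,
    (C • (-(a • (x n - (A ^ j) (x n))) + (A ^ j) (η n))
      + (C + 1) • modulus (μ ^ j • z n - (T ^ j) (z n))) with herr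
  have herr0 : ∀ N, Tendsto (err N) atTop (𝓝 0) := fun N => by
    rw [herr, ← Finset.sum_const_zero (s := Finset.range N)]
    refine tendsto_finsetSum _ fun j _ => ?_
    have h1 : Tendsto (fun n => modulus (μ ^ j • z n - (T ^ j) (z n))) atTop (𝓝 0) := by
      rw [tendsto_zero_iff_norm_tendsto_zero]
      have := tendsto_zero_iff_norm_tendsto_zero.1 (hzpow j)
      simpa only [norm_def] using this
    have h2 : Tendsto (fun n => (A ^ j) (η n)) atTop (𝓝 0) := by
      have := ((A ^ j).continuous.tendsto 0).comp hη
      rwa [map_zero] at this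
    simpa using ((((hxpow j).const_smul a).neg.add h2).const_smul C).add (h1.const_smul (C + 1))
  set V : ℕ → ℕ → Complexification E := fun N n =>
    ∑ j ∈ Finset.range N, ((μ ^ k)⁻¹) ^ j • (T ^ j) (w n) with hV
  have main : ∀ (N : ℕ) (n : ℕ), (N * (C + 1)) • (modulus (z n) - b • x n) ≤ modulus (V N n) + err N n := by
    intro N n
    have h1 := smul_modulus_le h hT hA hμ (hw n) N
    have h2 : ∑ j ∈ Finset.range N, (C • (A ^ j) (modulus (z n))
          + (C + 1) • modulus (μ ^ j • z n - (T ^ j) (z n)))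
        ≤ (N * (C + 1)) • b • x n + err N n := by
      have e : (N * (C + 1)) • b • x n = ∑ j ∈ Finset.range N, (C * a) • x n := by
        rw [Finset.sum_const, Finset.card_range, ← Nat.cast_smul_eq_nsmul ℝ, smul_smul, smul_smul]
        congr 1
        rw [hb]; field_simp
      rw [e, herr, ← Finset.sum_add_distrib]
      refine Finset.sum_le_sum fun j _ => ?_
      have h3 := smul_le_smul_of_nonneg_left (monotone_pow hA j (haη n)) hC
      rw [← add_assoc]
      gcongr
      refine h3.trans (le_of_eq ?_)
      rw [map_add, map_smul]
      module
    rw [smul_sub, sub_le_iff_le_add]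
    refine h1.trans ((add_le_add_right h2 _).trans (le_of_eq ?_))
    abel
  have hwx : ∀ n, modulus (w n) ≤ x n := fun n => (modulus_le_of_phasePow h (hw n)).trans (hzx n)
  -- `μ ^ k - T` leaves only the two end terms of the sum, so the main term does not grow with `N`.
  have hVn : ∀ N n, ‖V N n‖ ≤ M * (2 * ‖x n‖ + ‖x n - (A ^ N) (x n)‖) := fun N n => by
    refine (hM _).trans (mul_le_mul_of_nonneg_left ?_ hM0)
    rw [hV, smul_sum_pow_sub_apply T hμ0, norm_smul, hμk, one_mul]
    refine (norm_sub_le _ _).trans ?_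
    rw [norm_smul, norm_pow, norm_inv, hμk, inv_one, one_pow, one_mul]
    have h1 : ‖w n‖ ≤ ‖x n‖ := norm_le_of_le (modulus_nonneg _) (hwx n)
    have h2 : ‖(T ^ N) (w n)‖ ≤ ‖(A ^ N) (x n)‖ := norm_le_of_le (modulus_nonneg _)
      (((hT.pow N).modulus_apply_le (monotone_pow hA N) (w n)).trans (monotone_pow hA N (hwx n)))
    have h3 : ‖(A ^ N) (x n)‖ ≤ ‖x n‖ + ‖x n - (A ^ N) (x n)‖ := norm_le_norm_add_norm_sub _ _
    linarith
  refine ⟨fun n => (modulus (z n) - b • x n)⁺, tendsto_zero_of_norm_le_add fun ε hε => ?_,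
    fun n => by rw [← sub_le_iff_le_add']; exact le_posPart _⟩
  -- Averaging over `N + 1` steps brings the bounded contribution `2MB` of `V` below `ε`.
  obtain ⟨N, hN⟩ := exists_nat_gt (M * (2 * B) / ε)
  have hεN : M * (2 * B) < (N + 1 : ℕ) * ε := by
    rw [div_lt_iff₀ hε] at hN
    push_cast; linarith
  refine ⟨fun n => M * ‖x n - (A ^ (N + 1)) (x n)‖ + ‖err (N + 1) n‖, ?_, ?_⟩
  · simpa using ((hxpow (N + 1)).norm.const_mul M).add (herr0 (N + 1)).norm
  · filter_upwards [hB] with n hn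
    set L : ℝ := (N + 1 : ℕ) * (C + 1) with hL
    have hN1 : (1 : ℝ) ≤ (N + 1 : ℕ) := by push_cast; linarith [N.cast_nonneg (α := ℝ)]
    have hNL : ((N + 1 : ℕ) : ℝ) ≤ L := le_mul_of_one_le_right (by linarith) (by linarith)
    have hL0 : 0 < L := by linarith
    have h1 : L • (modulus (z n) - b • x n)⁺ ≤ modulus (V (N + 1) n) + |err (N + 1) n| := by
      rw [← le_inv_smul_iff_of_pos hL0, posPart_def]
      refine sup_le ?_ (smul_nonneg (inv_pos.2 hL0).le
        (add_nonneg (modulus_nonneg _) (abs_nonneg _)))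
      rw [le_inv_smul_iff_of_pos hL0]
      exact (main (N + 1) n).trans (add_le_add_right (le_abs_self _) _)
    have h2 := (norm_le_of_le (smul_nonneg hL0.le (posPart_nonneg _)) h1).trans (norm_add_le _ _)
    rw [norm_smul, Real.norm_eq_abs, abs_of_pos hL0, norm_abs_eq_norm] at h2
    have h3 := hVn (N + 1) n
    rw [norm_def] at h3
    set p := ‖(modulus (z n) - b • x n)⁺‖
    set e := M * ‖x n - (A ^ (N + 1)) (x n)‖ + ‖err (N + 1) n‖ with he
    have h4 : L * p ≤ M * (2 * B) + e := by
      have : M * (2 * ‖x n‖) ≤ M * (2 * B) := by gcongr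
      rw [he]; linarith
    have he0 : 0 ≤ e := by positivity
    have h5 : L * p ≤ L * (ε + e) := by
      have h6 : (N + 1 : ℕ) * ε ≤ L * ε := mul_le_mul_of_nonneg_right hNL hε.le
      have h7 : e ≤ L * e := le_mul_of_one_le_left he0 (hN1.trans hNL)
      linarith
    exact le_of_mul_le_mul_left h5 hL0

/-- Starting from `a = 1`, repeated improvement gives the constants `(C/(C+1))^p`, which tend to 0
while `x` stays bounded. -/
theorem tendsto_zero_of_dominated {k : ℤ}
    (hT : IsComplexExtension T A) (hA : Monotone A) {μ : ℂ} (hμ : ‖μ‖ = 1) {M B : ℝ}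
    (hM0 : 0 ≤ M) (hM : ∀ v, ‖v‖ ≤ M * ‖μ ^ k • v - T v‖)
    {z : ℕ → Complexification E} {x : ℕ → E} (hB : ∀ᶠ n in atTop, ‖x n‖ ≤ B)
    (hx : Tendsto (fun n => x n - A (x n)) atTop (𝓝 0))
    (hz : Tendsto (fun n => μ • z n - T (z n)) atTop (𝓝 0))
    (hzx : ∀ n, modulus (z n) ≤ x n) : Tendsto z atTop (𝓝 0) := by
  obtain ⟨C, hC⟩ := exists_isPhaseBound k
  have hC0 : 0 < C := zero_lt_one.trans_le hC.1
  have key : ∀ p : ℕ, ∃ η : ℕ → E, Tendsto η atTop (𝓝 0) ∧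
      ∀ n, modulus (z n) ≤ (C / (C + 1)) ^ p • x n + η n := by
    intro p
    induction p with
    | zero => exact ⟨0, tendsto_const_nhds, fun n => by simpa using hzx n⟩
    | succ p ih =>
      rw [pow_succ']
      exact exists_modulus_le_improved hC hT hA hμ hM0 hM hB hx hz hzx ih
  refine tendsto_zero_of_norm_le_add fun ε hε => ?_
  have hB0 : 0 ≤ B := by
    obtain ⟨n, hn⟩ := hB.exists
    exact (norm_nonneg _).trans hn
  obtain ⟨p, hp⟩ := exists_pow_lt_of_lt_one (show 0 < ε / (B + 1) by positivity)
    (show C / (C + 1) < 1 by rw [div_lt_one (by linarith)]; linarith)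
  obtain ⟨η, hη, h⟩ := key p
  refine ⟨fun n => ‖η n‖, by simpa using hη.norm, ?_⟩
  filter_upwards [hB] with n hn
  have h1 := (norm_le_of_le (modulus_nonneg _) (h n)).trans (norm_add_le _ _)
  have hq : 0 ≤ (C / (C + 1)) ^ p := by positivity
  rw [norm_smul, Real.norm_eq_abs, abs_of_nonneg hq] at h1
  rw [lt_div_iff₀ (by linarith)] at hp
  have h2 : (C / (C + 1)) ^ p * ‖x n‖ ≤ (C / (C + 1)) ^ p * (B + 1) := by
    gcongr; linarith
  rw [norm_def]
  linarith

/-- A positive operator is the complex extension of a positive operator on the real part. -/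
theorem exists_isComplexExtension (hT : IsPositiveOperator T) :
    ∃ A : E →L[ℝ] E, IsComplexExtension T A ∧ Monotone A := by
  have nonneg : ∀ x : E, 0 ≤ x → 0 ≤ (T (ofReal x)).re ∧ (T (ofReal x)).im = 0 := fun x hx => by
    have := hT (ofReal x) ⟨hx, rfl⟩
    exact ⟨this.1, this.2.symm⟩
  have hadd : ∀ x y : E, ofReal (x + y) = ofReal x + ofReal y := fun x y => by
    ext <;> simp [ofReal]
  -- Positivity controls only the cone; real elements are differences of positive ones.
  have him : ∀ x : E, (T (ofReal x)).im = 0 := fun x => by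
    have e : ofReal x = ofReal x⁺ - ofReal x⁻ := by
      ext <;> simp [ofReal]
    rw [e, map_sub, sub_im, (nonneg _ (posPart_nonneg x)).2, (nonneg _ (negPart_nonneg x)).2,
      sub_zero]
  let A₀ : E →ₗ[ℝ] E :=
    { toFun := fun x => (T (ofReal x)).re
      map_add' := fun x y => by rw [hadd, map_add, add_re]
      map_smul' := fun t x => by
        have : ofReal (t • x) = (t : ℂ) • ofReal x := by
          ext <;> simp [ofReal, -Complex.coe_smul]
        rw [this, map_smul, smul_re]
        simp }
  refine ⟨A₀.mkContinuous ‖T‖ fun x => ?_, fun z => ?_, fun x y hxy => ?_⟩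
  · refine (norm_re_le _).trans ((T.le_opNorm _).trans (le_of_eq ?_))
    rw [norm_def (ofReal x), modulus_ofReal, norm_abs_eq_norm]
  · have e : z = ofReal z.re + Complex.I • ofReal z.im := by ext <;> simp [ofReal]
    conv_lhs => rw [e]
    rw [map_add, map_smul]
    ext <;> simp [him, A₀]
  · have := (nonneg (y - x) (sub_nonneg.2 hxy)).1
    change 0 ≤ A₀ (y - x) at this
    rw [map_sub, sub_nonneg] at this
    exact this

end PositiveOperator

end Complexification

/-! ### Resolvent bound, approximate eigenvectors and the conclusion. -/

theorem exists_norm_le_of_notMem_spectrum {X : Type*} [NormedAddCommGroup X] [NormedSpace ℂ X]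
    {T : X →L[ℂ] X} {μ : ℂ} (h : μ ∉ spectrum ℂ T) :
    ∃ M : ℝ, 0 ≤ M ∧ ∀ v, ‖v‖ ≤ M * ‖μ • v - T v‖ := by
  obtain ⟨u, hu⟩ := spectrum.notMem_iff.1 h
  refine ⟨‖(u⁻¹.1 : X →L[ℂ] X)‖, norm_nonneg _, fun v => ?_⟩
  have e : (u⁻¹.1 : X →L[ℂ] X) (μ • v - T v) = v := by
    have h1 : (u.1 : X →L[ℂ] X) v = μ • v - T v := by
      rw [hu]; simp [Algebra.algebraMap_eq_smul_one]
    rw [← h1, ← mul_apply_eq_comp, Units.inv_mul, one_apply_eq_self]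
  conv_lhs => rw [← e]
  exact ContinuousLinearMap.le_opNorm _ _

theorem IsApproximateEigenvector.exists_norm_le {X : Type*} [NormedAddCommGroup X]
    [NormedSpace ℂ X] {T : X →L[ℂ] X} {μ : ℂ} {x : ℕ → X} (h : IsApproximateEigenvector T μ x) :
    ∃ B : ℝ, ∀ᶠ n in atTop, ‖x n‖ ≤ B := by
  obtain ⟨b, hb, hb'⟩ := exists_between h.2.1
  refine ⟨b.toReal, (eventually_lt_of_limsup_lt hb).mono fun n hn => ?_⟩
  have := ENNReal.toReal_mono hb'.ne hn.le
  rwa [toReal_enorm] at this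

theorem IsApproximateEigenvector.not_tendsto_zero {X : Type*} [NormedAddCommGroup X]
    [NormedSpace ℂ X] {T : X →L[ℂ] X} {μ : ℂ} {x : ℕ → X} (h : IsApproximateEigenvector T μ x) :
    ¬ Tendsto x atTop (𝓝 0) := fun hx => by
  have h1 : Tendsto (fun n => ‖x n‖ₑ) atTop (𝓝 0) := by
    have := (continuous_enorm.tendsto (0 : X)).comp hx
    rwa [enorm_zero] at this
  exact h.1.ne' h1.liminf_eq

theorem mainTheorem3 {E : Type*} [NormedAddCommGroup E] [Lattice E] [HasSolidNorm E]
    [IsOrderedAddMonoid E] [NormedSpace ℝ E] [IsOrderedModule ℝ E] [CompleteSpace E]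
    (T : Complexification E →L[ℂ] Complexification E) (hT : IsPositiveOperator T)
    (r θ : ℝ) (hr : 0 < r)
    (heig : IsApproximateEigenvalue T (r * Complex.exp (θ * Complex.I)))
    (hdom : DominatedApproximateEigenvectorCondition T (r * Complex.exp (θ * Complex.I)))
    (k : ℤ) :
    (r * Complex.exp (k * θ * Complex.I) : ℂ) ∈ spectrum ℂ T := by
  by_contra hk
  obtain ⟨z, x, hz, hx, hzx⟩ := hdom
  set μ : ℂ := Complex.exp (θ * Complex.I) with hμ
  have hμ1 : ‖μ‖ = 1 := Complex.norm_exp_ofReal_mul_I θ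
  have hnorm : ((‖(r : ℂ) * μ‖ : ℝ) : ℂ) = r := by
    rw [norm_mul, hμ1, mul_one, Complex.norm_real, Real.norm_eq_abs, abs_of_pos hr]
  rw [hnorm] at hx
  have hr0 : (r : ℂ) ≠ 0 := by exact_mod_cast hr.ne'
  rw [mul_assoc, Complex.exp_int_mul, ← hμ] at hk
  obtain ⟨M, hM0, hM⟩ := exists_norm_le_of_notMem_spectrum hk
  obtain ⟨A, hA, hmono⟩ := Complexification.exists_isComplexExtension hT
  obtain ⟨B, hB⟩ := hx.exists_norm_le
  have scale : ∀ (c : ℂ) v, c • v - ((r : ℂ)⁻¹ • T) v = (r : ℂ)⁻¹ • (((r : ℂ) * c) • v - T v) :=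
    fun c v => by
      rw [smul_sub, smul_smul, inv_mul_cancel_left₀ hr0, smul_apply]
  -- Normalising `T` by `r⁻¹` shrinks the defect `r μ ^ k v - T v` by `r`, hence the constant `M *
  -- r`.
  refine hz.not_tendsto_zero (Complexification.tendsto_zero_of_dominated (k := k)
    (T := (r : ℂ)⁻¹ • T) (A := r⁻¹ • A) (μ := μ) (M := M * r) (x := fun n => (x n).re)
    (fun v => ?_) (fun u v huv => ?_) hμ1 (mul_nonneg hM0 hr.le) (fun v => ?_)
    (hB.mono fun n hn => (Complexification.norm_re_le _).trans hn) ?_ ?_ fun n => (hzx n).1)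
  · rw [smul_apply, hA v, ← Complex.ofReal_inv]
    ext <;> simp
  · exact smul_le_smul_of_nonneg_left (hmono huv) (inv_pos.2 hr).le
  · rw [scale, norm_smul, norm_inv, Complex.norm_real, Real.norm_eq_abs, abs_of_pos hr, mul_assoc,
      mul_inv_cancel_left₀ hr.ne']
    exact hM v
  · have h1 := hx.2.2.const_smul (r : ℂ)⁻¹
    rw [smul_zero] at h1
    refine squeeze_zero_norm (fun n => ?_) (tendsto_zero_iff_norm_tendsto_zero.1 h1)
    have e : (x n).re - (r⁻¹ • A) (x n).re = ((r : ℂ)⁻¹ • ((r : ℂ) • x n - T (x n))).re := by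
      rw [smul_sub, inv_smul_smul₀ hr0, hA (x n), ← Complex.ofReal_inv]
      simp
    rw [e]
    exact Complexification.norm_re_le _
  · simp only [scale]
    simpa using hz.2.2.const_smul (r : ℂ)⁻¹
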